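/- Let $G$ be a finite group, $k$ a commutative ring (for example a field) and $n\ge 0$ an integer. For a $kH$-module $A$ over a group $H$, let $C^n(H,A)=\mathrm{Maps}(H^n,A)$ be the usual inhomogeneous cochain complex with differential $\partial$, let $\Sigma_{n+1}$ act on $C^n(H,A)$ by letting $\sigma_i=(i,i+1)$, $1\le i\le n$, send $f$ to $$(\sigma_i f)(h_1,\dots,h_n)=-f(h_1,\dots,h_{i-1}h_i,\,h_i^{-1},\,h_ih_{i+1},\dots,h_n),$$ where entries with index outside $\{1,\dots,n\}$ are omitted and, if $i=1$, the right-hand side is in addition multiplied on the left by $h_1$. The symmetric cohomology $\mathrm{HS}^n(H,A)$ is the cohomology of the subcomplex $CS^*(H,A)$ of $\Sigma_{*+1}$-invariant cochains. Let $\alpha:G\times G\to k^\times$ be a 2-cocycle, i.e. $\alpha(x,yz)\alpha(y,z)=\alpha(xy,z)\alpha(x,y)$, and let $k_\alpha G$ be the twisted group algebra, with $k$-basis $\{\bar g: g\in G\}$ and $\bar g\cdot\bar h=\alpha(g,h)\overline{gh}$. Let $C^n(k_\alpha G)=\mathrm{Hom}_k((k_\alpha G)^{\otimes n},k_\alpha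 G)$ be the Hochschild cochain complex with the usual differential, and let $\Sigma_{n+1}$ act on it through $$(\sigma_i\varphi)(\bar g_1\otimes\dots\otimes\bar g_n)=-\varphi(\bar g_1\otimes\dots\otimes\bar g_{i-1}\bar g_i\otimes\bar g_i^{-1}\otimes\bar g_i\bar g_{i+1}\otimes\dots\otimes\bar g_n),$$ where the right-hand side is in addition multiplied by $\bar g_1$ on the left if $i=1$ and by $\bar g_n$ on the right if $i=n$. The symmetric Hochschild cohomology $\mathrm{HHS}^n(k_\alpha G)$ is the cohomology of the subcomplex of $\Sigma_{*+1}$-invariant cochains. For $x\in G$ and $\varphi\in C^n(k_\alpha G)$ let $\pi^n_{G,x,\alpha}(\varphi)(h_1,\dots,h_n)=a\,\bar x$ for $h_1,\dots,h_n\in C_G(x)$, where $a$ is the coefficient of $\bar x$ in $\varphi(\bar h_1\otimes\dots\otimes\bar h_n)\cdot\bar h_n^{-1}\cdots\bar h_1^{-1}$. For $x\in Z(G)$ let $k\bar x$ be the $kG$-module that is free of rank one over $k$ on $\bar x$, with $g\bar x=\alpha(g,x)\alpha(x,g)^{-1}\bar x$, and for $\psi\in C^n(G,k\bar x)$ let $\nu^n_{G,x,\alpha}(\psi)(\bar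 g_1\otimes\dots\otimes\bar g_n)=\psi(g_1,\dots,g_n)\cdot\bar g_1\cdots\bar g_n$. (a) For every $x\in Z(G)$ the maps $\nu^n_{G,x,\alpha}$ and $\pi^n_{G,x,\alpha}$ take symmetric cocycles to symmetric cocycles and induce well-defined $k$-linear maps $\nu^{n,S}_{G,x,\alpha}:\mathrm{HS}^n(G,k\bar x)\to\mathrm{HHS}^n(k_\alpha G)$ and $\pi^{n,S}_{G,x,\alpha}:\mathrm{HHS}^n(k_\alpha G)\to\mathrm{HS}^n(G,k\bar x)$. The map $$\bigoplus_{x\in Z(G)}\nu^{n,S}_{G,x,\alpha}:\bigoplus_{x\in Z(G)}\mathrm{HS}^n(G,k\bar x)\to\mathrm{HHS}^n(k_\alpha G)$$ is injective, and the map $\bigoplus_{x\in Z(G)}\pi^{n,S}_{G,x,\alpha}:\mathrm{HHS}^n(k_\alpha G)\to\bigoplus_{x\in Z(G)}\mathrm{HS}^n(G,k\bar x)$ is surjective and is a left inverse of it. (b) Let $\alpha=\mathbf 1_k$ be the trivial cocycle, so that $k_\alpha G=kG$. Let $X$ be any system of representatives of the conjugacy classes of $G$, and for each $x\in X$ let $T_x\ni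 1$ be a set of representatives of the right cosets $C_G(x)t$ of $C_G(x)$ in $G$. For $\psi\in C^n(C_G(x),k)$ ($k$ the trivial module) let $$\nu^n_{G,x}(\psi)(g_1\otimes\dots\otimes g_n)=\sum_{t\in T_x}\psi(h_{t,1},\dots,h_{t,n})\,t^{-1}xt\,g_1\cdots g_n,$$ where $h_{t,i}\in C_G(x)$ and $t_i\in T_x$ are determined by $t_0=t$ and $t_{i-1}g_i=h_{t,i}t_i$ for $1\le i\le n$; let $\pi^n_{G,x}=\pi^n_{G,x,\mathbf 1_k}$, with $kx$ identified with $k$. For every $x\in X$ these maps take symmetric cocycles to symmetric cocycles and induce well-defined $k$-linear maps $\nu^{n,S}_{G,x}:\mathrm{HS}^n(C_G(x),k)\to\mathrm{HHS}^n(kG)$ and $\pi^{n,S}_{G,x}:\mathrm{HHS}^n(kG)\to\mathrm{HS}^n(C_G(x),k)$. The map $$\bigoplus_{x\in X}\nu^{n,S}_{G,x}:\bigoplus_{x\in X}\mathrm{HS}^n(C_G(x),k)\to\mathrm{HHS}^n(kG)$$ is injective, and the map $\bigoplus_{x\in X}\pi^{n,S}_{G,x}:\mathrm{HHS}^n(kG)\to\bigoplus_{x\in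 X}\mathrm{HS}^n(C_G(x),k)$ is surjective and is a left inverse of it. -/

import Mathlib

/-! ### Symmetric cohomology of groups -/

/-- For `i : Fin n` (standing for the transposition `σ_{i+1} = (i+1, i+2)` of `Σ_{n+1}`), the tuple
`(g₁, …, g_{i-1} g_i, g_i⁻¹, g_i g_{i+1}, …, g_n)`; at the two ends of the tuple the missing
neighbour is simply omitted. -/
def swapTuple {H : Type*} [Group H] {n : ℕ} (i : Fin n) (g : Fin n → H) : Fin n → H := fun j =>
  if (j : ℕ) + 1 = i then g j * g i
  else if (j : ℕ) = i then (g i)⁻¹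
  else if (j : ℕ) = (i : ℕ) + 1 then g i * g j
  else g j

section GroupCochains

variable {k G A : Type*} [CommRing k] [Group G] [AddCommGroup A] [Module k A]

/-- The differential `∂ⁿ : Cⁿ(G, A) → Cⁿ⁺¹(G, A)` of inhomogeneous cochains
(the last summand, `j = n`, is `(-1)^(n+1) f(g₁, …, g_n)`). -/
def groupDifferential (ρ : Representation k G A) (n : ℕ) :
    ((Fin n → G) → A) →ₗ[k] ((Fin (n + 1) → G) → A) where
  toFun f g := ρ (g 0) (f fun i => g i.succ) +
    ∑ j : Fin (n + 1), (-1 : k) ^ ((j : ℕ) + 1) • f (Fin.contractNth j (· * ·) g)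
  map_add' f f' := by
    ext g
    simp [Finset.sum_add_distrib, add_add_add_comm]
  map_smul' c f := by
    ext g
    simp [Finset.smul_sum, ← smul_assoc, mul_comm c]

/-- The action of the transposition `σ_{i+1} = (i+1, i+2)` of `Σ_{n+1}` on `Cⁿ(G, A)`. -/
def groupTransposition (ρ : Representation k G A) {n : ℕ} (i : Fin n) :
    ((Fin n → G) → A) →ₗ[k] ((Fin n → G) → A) where
  toFun f g := -(ρ (if (i : ℕ) = 0 then g i else 1) (f (swapTuple i g)))
  map_add' f f' := by
    ext g
    simp [add_comm]
  map_smul' c f := by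
    ext g
    simp

/-- `CSⁿ(G, A)`: the cochains fixed by `Σ_{n+1}`, that is, by its generating transpositions. -/
def symCochains (ρ : Representation k G A) (n : ℕ) : Submodule k ((Fin n → G) → A) :=
  ⨅ i : Fin n, LinearMap.eqLocus (groupTransposition ρ i) LinearMap.id

/-- The cocycles of the symmetric cochain complex `CS*(G, A)`. -/
def symCocycles (ρ : Representation k G A) (n : ℕ) : Submodule k ((Fin n → G) → A) :=
  symCochains ρ n ⊓ LinearMap.ker (groupDifferential ρ n)

/-- The coboundaries of the symmetric cochain complex `CS*(G, A)`: the images of *symmetric*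
cochains. -/
def symCoboundaries (ρ : Representation k G A) : (n : ℕ) → Submodule k ((Fin n → G) → A)
  | 0 => ⊥
  | n + 1 => (symCochains ρ n).map (groupDifferential ρ n)

/-- The symmetric cohomology `HSⁿ(G, A)`. -/
abbrev HS (ρ : Representation k G A) (n : ℕ) : Type _ :=
  symCocycles ρ n ⧸ (symCoboundaries ρ n).submoduleOf (symCocycles ρ n)

/-- The class of a symmetric cocycle in `HSⁿ(G, A)`. -/
abbrev HS.mk (ρ : Representation k G A) (n : ℕ) : symCocycles ρ n →ₗ[k] HS ρ n :=
  Submodule.mkQ _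

end GroupCochains

/-! ### The twisted group algebra -/

/-- A 2-cocycle of `G` with values in `kˣ` (trivial action), not assumed to be normalized. -/
structure TwoCocycle (G k : Type*) [Group G] [CommRing k] where
  toFun : G → G → kˣ
  cocycle : ∀ x y z, toFun x (y * z) * toFun y z = toFun (x * y) z * toFun x y

namespace TwoCocycle

variable {G k : Type*} [Group G] [CommRing k]

instance : CoeFun (TwoCocycle G k) (fun _ => G → G → kˣ) := ⟨TwoCocycle.toFun⟩

/-- The trivial 2-cocycle `1_k`. -/
def trivial (G k : Type*) [Group G] [CommRing k] : TwoCocycle G k where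
  toFun _ _ := 1
  cocycle _ _ _ := rfl

theorem one_left (α : TwoCocycle G k) (g : G) : α 1 g = α 1 1 := by
  have h := α.cocycle 1 1 g
  simp only [one_mul] at h
  exact mul_left_cancel h

theorem one_right (α : TwoCocycle G k) (g : G) : α g 1 = α 1 1 := by
  have h := α.cocycle g 1 1
  simp only [mul_one] at h
  exact (mul_left_cancel h).symm

theorem inv_comm (α : TwoCocycle G k) (g : G) : α g⁻¹ g = α g g⁻¹ := by
  have h := α.cocycle g g⁻¹ g
  rw [inv_mul_cancel, mul_inv_cancel, α.one_left g, α.one_right g] at h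
  exact mul_left_cancel h

/-- For `x ∈ Z(G)`, the `kG`-module `k x̄`: the free `k`-module of rank one on `x̄` (elements `a x̄`
are written as `a : k`), with `g x̄ = α(g, x) α(x, g)⁻¹ x̄`. -/
def lineRep (α : TwoCocycle G k) (x : Subgroup.center G) : Representation k G k where
  toFun g := ((α g x * (α x g)⁻¹ : kˣ) : k) • LinearMap.id
  map_one' := by
    rw [α.one_left x, α.one_right x, mul_inv_cancel]
    ext
    simp
  map_mul' g h := by
    have hc (y : G) : y * x = x * y := Subgroup.mem_center_iff.mp x.2 y
    have key : α (g * h) x * (α x (g * h))⁻¹ = (α g x * (α x g)⁻¹) * (α h x * (α x h)⁻¹) := by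
      have h1 := α.cocycle g h x
      have h2 := α.cocycle g x h
      have h3 := α.cocycle x g h
      rw [hc h] at h1
      rw [hc g] at h2
      have e1 : α (g * h) x = α g (x * h) * α h x * (α g h)⁻¹ := eq_mul_inv_of_mul_eq h1.symm
      have e2 : α g (x * h) = α (x * g) h * α g x * (α x h)⁻¹ := eq_mul_inv_of_mul_eq h2
      have e3 : α x (g * h) = α (x * g) h * α x g * (α g h)⁻¹ := eq_mul_inv_of_mul_eq h3
      rw [e1, e2, e3]
      simp only [mul_inv_rev, inv_inv]
      calc _ = (α (x * g) h * (α (x * g) h)⁻¹) * ((α g h)⁻¹ * α g h) *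
          ((α g x * (α x g)⁻¹) * (α h x * (α x h)⁻¹)) := by
            simp only [mul_comm, mul_left_comm, mul_assoc]
        _ = _ := by simp
    rw [key]
    ext
    simp
    ring

end TwoCocycle

/-- The twisted group algebra `k_α G`: the free `k`-module on `G`, with basis elements `ḡ`, and
`ḡ · h̄ = α(g, h) \overline{gh}`. -/
def TwistedGroupAlgebra {G k : Type*} [Group G] [CommRing k] (_α : TwoCocycle G k) : Type _ :=
  G →₀ k

namespace TwistedGroupAlgebra

variable {G k : Type*} [Group G] [CommRing k] (α : TwoCocycle G k)

noncomputable instance : AddCommGroup (TwistedGroupAlgebra α) :=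
  inferInstanceAs (AddCommGroup (G →₀ k))

noncomputable instance : Module k (TwistedGroupAlgebra α) :=
  inferInstanceAs (Module k (G →₀ k))

/-- The `k`-basis `ḡ`, `g ∈ G`, of `k_α G`. -/
noncomputable def basis : Module.Basis G k (TwistedGroupAlgebra α) :=
  Module.Basis.ofRepr (LinearEquiv.refl k (G →₀ k))

/-- The multiplication of `k_α G`. -/
noncomputable def mulHom :
    TwistedGroupAlgebra α →ₗ[k] TwistedGroupAlgebra α →ₗ[k] TwistedGroupAlgebra α :=
  (basis α).constr k fun g => (basis α).constr k fun h => (α g h : k) • basis α (g * h)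

theorem mulHom_basis (g h : G) :
    mulHom α (basis α g) (basis α h) = (α g h : k) • basis α (g * h) := by
  simp [mulHom, Module.Basis.constr_basis]

theorem mulHom_assoc (a b c : TwistedGroupAlgebra α) :
    mulHom α (mulHom α a b) c = mulHom α a (mulHom α b c) := by
  have h1 (x y : G) (c) : mulHom α (mulHom α (basis α x) (basis α y)) c =
      mulHom α (basis α x) (mulHom α (basis α y) c) := by
    refine LinearMap.congr_fun (f := mulHom α (mulHom α (basis α x) (basis α y)))
      (g := mulHom α (basis α x) ∘ₗ mulHom α (basis α y)) ((basis α).ext fun z => ?_) c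
    simp only [LinearMap.comp_apply, mulHom_basis, map_smul, LinearMap.smul_apply, smul_smul,
      mul_assoc]
    have h : ((α x y * α (x * y) z : kˣ) : k) = ((α y z * α x (y * z) : kˣ) : k) := by
      rw [mul_comm, ← α.cocycle, mul_comm]
    push_cast at h
    rw [h]
  have h2 (x : G) (b c) : mulHom α (mulHom α (basis α x) b) c =
      mulHom α (basis α x) (mulHom α b c) := by
    refine LinearMap.congr_fun (f := (mulHom α).flip c ∘ₗ mulHom α (basis α x))
      (g := mulHom α (basis α x) ∘ₗ (mulHom α).flip c) ((basis α).ext fun z => ?_) b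
    exact h1 x z c
  refine LinearMap.congr_fun (f := (mulHom α).flip c ∘ₗ (mulHom α).flip b)
    (g := (mulHom α).flip (mulHom α b c)) ((basis α).ext fun z => ?_) a
  exact h2 z b c

theorem one_mulHom (a : TwistedGroupAlgebra α) :
    mulHom α ((((α 1 1)⁻¹ : kˣ) : k) • basis α 1) a = a := by
  refine LinearMap.congr_fun (f := mulHom α ((((α 1 1)⁻¹ : kˣ) : k) • basis α 1))
    (g := LinearMap.id) ((basis α).ext fun z => ?_) a
  simp [mulHom_basis, α.one_left z, smul_smul]

theorem mulHom_one (a : TwistedGroupAlgebra α) :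
    mulHom α a ((((α 1 1)⁻¹ : kˣ) : k) • basis α 1) = a := by
  refine LinearMap.congr_fun (f := (mulHom α).flip ((((α 1 1)⁻¹ : kˣ) : k) • basis α 1))
    (g := LinearMap.id) ((basis α).ext fun z => ?_) a
  simp [mulHom_basis, α.one_right z, smul_smul]

noncomputable instance : Ring (TwistedGroupAlgebra α) where
  __ := (inferInstance : AddCommGroup (TwistedGroupAlgebra α))
  mul a b := mulHom α a b
  one := (((α 1 1)⁻¹ : kˣ) : k) • basis α 1
  left_distrib a b c := map_add (mulHom α a) b c
  right_distrib a b c := LinearMap.congr_fun (map_add (mulHom α) a b) c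
  zero_mul a := LinearMap.congr_fun (map_zero (mulHom α)) a
  mul_zero a := map_zero (mulHom α a)
  mul_assoc := mulHom_assoc α
  one_mul := one_mulHom α
  mul_one := mulHom_one α

noncomputable instance : Algebra k (TwistedGroupAlgebra α) :=
  Algebra.ofModule
    (fun c a b => LinearMap.congr_fun (map_smul (mulHom α) c a) b)
    (fun c a b => map_smul (mulHom α a) c b)

theorem basis_mul_basis (g h : G) :
    basis α g * basis α h = (α g h : k) • basis α (g * h) :=
  mulHom_basis α g h

theorem one_def : (1 : TwistedGroupAlgebra α) = (((α 1 1)⁻¹ : kˣ) : k) • basis α 1 := rfl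

/-- `ḡ` as an invertible element of `k_α G`. -/
noncomputable def unit (g : G) : (TwistedGroupAlgebra α)ˣ where
  val := basis α g
  inv := (((α 1 1)⁻¹ * (α g g⁻¹)⁻¹ : kˣ) : k) • basis α g⁻¹
  val_inv := by
    rw [mul_smul_comm, basis_mul_basis, smul_smul, mul_inv_cancel, one_def, ← Units.val_mul]
    simp
  inv_val := by
    rw [smul_mul_assoc, basis_mul_basis, smul_smul, inv_mul_cancel, one_def, ← Units.val_mul,
      α.inv_comm]
    simp

end TwistedGroupAlgebra

/-! ### Symmetric Hochschild cohomology of twisted group algebras -/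

section Hochschild

variable {k A : Type*} [CommRing k] [Ring A] [Algebra k A]

/-- Merging two neighbouring arguments of a tuple is linear in each argument. -/
theorem contractNth_update {n : ℕ} (j : Fin n) (a : Fin (n + 1) → A) (i : Fin (n + 1)) :
    ∃ (i' : Fin n) (L : A →ₗ[k] A), ∀ c, Fin.contractNth j.castSucc (· * ·) (Function.update a i c) =
      Function.update (Fin.contractNth j.castSucc (· * ·) a) i' (L c) := by
  rcases lt_trichotomy (i : ℕ) j with h | h | h
  · refine ⟨⟨i, by omega⟩, LinearMap.id, fun c => ?_⟩
    ext l
    simp only [Fin.contractNth, Function.update_apply, Fin.ext_iff, LinearMap.id_apply,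
      Fin.val_castSucc, Fin.val_succ]
    split_ifs <;> first | rfl | omega
  · obtain rfl : i = j.castSucc := Fin.ext h
    refine ⟨j, LinearMap.mulRight k (a j.succ), fun c => ?_⟩
    ext l
    by_cases hl : l = j
    · subst hl
      simp [Fin.contractNth, Fin.ext_iff]
    · simp only [Fin.contractNth, Function.update_apply, Fin.ext_iff,
        Fin.val_castSucc, Fin.val_succ]
      split_ifs <;> first | rfl | omega
  · by_cases h' : (i : ℕ) = j + 1
    · obtain rfl : i = j.succ := Fin.ext (by simpa using h')
      refine ⟨j, LinearMap.mulLeft k (a j.castSucc), fun c => ?_⟩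
      ext l
      by_cases hl : l = j
      · subst hl
        simp [Fin.contractNth, Fin.ext_iff]
      · simp only [Fin.contractNth, Function.update_apply, Fin.ext_iff,
          Fin.val_castSucc, Fin.val_succ]
        split_ifs <;> first | rfl | omega
    · refine ⟨⟨i - 1, by omega⟩, LinearMap.id, fun c => ?_⟩
      ext l
      simp only [Fin.contractNth, Function.update_apply, Fin.ext_iff, LinearMap.id_apply,
        Fin.val_castSucc, Fin.val_succ]
      split_ifs <;> first | rfl | omega

/-- The Hochschild cochain `(a₁, …, a_{n+1}) ↦ φ(a₁, …, a_j a_{j+1}, …, a_{n+1})`. -/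
def hochschildInnerFace {n : ℕ} (j : Fin n) :
    MultilinearMap k (fun _ : Fin n => A) A →ₗ[k]
      MultilinearMap k (fun _ : Fin (n + 1) => A) A where
  toFun φ := MultilinearMap.mk' (fun a => φ (Fin.contractNth j.castSucc (· * ·) a))
    (fun a i x y => by
      obtain ⟨i', L, h⟩ := contractNth_update (k := k) j a i
      simp only [h, map_add, MultilinearMap.map_update_add])
    (fun a i c x => by
      obtain ⟨i', L, h⟩ := contractNth_update (k := k) j a i
      simp only [h, map_smul, MultilinearMap.map_update_smul])
  map_add' _ _ := rfl
  map_smul' _ _ := rfl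

/-- The Hochschild cochain `(a₁, …, a_{n+1}) ↦ a₁ · φ(a₂, …, a_{n+1})`. -/
def hochschildFirstFace (n : ℕ) :
    MultilinearMap k (fun _ : Fin n => A) A →ₗ[k]
      MultilinearMap k (fun _ : Fin (n + 1) => A) A where
  toFun φ := LinearMap.uncurryLeft
    { toFun := fun a => (LinearMap.mulLeft k a).compMultilinearMap φ
      map_add' := fun a b => by ext; simp [add_mul]
      map_smul' := fun c a => by ext; simp }
  map_add' φ φ' := by ext; simp [LinearMap.uncurryLeft_apply]
  map_smul' c φ := by ext; simp [LinearMap.uncurryLeft_apply]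

/-- The Hochschild cochain `(a₁, …, a_{n+1}) ↦ φ(a₁, …, a_n) · a_{n+1}`. -/
def hochschildLastFace (n : ℕ) :
    MultilinearMap k (fun _ : Fin n => A) A →ₗ[k]
      MultilinearMap k (fun _ : Fin (n + 1) => A) A where
  toFun φ := MultilinearMap.uncurryRight ((LinearMap.mul k A).compMultilinearMap φ)
  map_add' φ φ' := by ext; simp
  map_smul' c φ := by ext; simp

/-- The Hochschild differential `δⁿ : Cⁿ(A, A) → Cⁿ⁺¹(A, A)`, where `Cⁿ(A, A) = Hom_k(A^{⊗ n}, A)`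
is the module of `k`-multilinear maps. -/
def hochschildDifferential (k A : Type*) [CommRing k] [Ring A] [Algebra k A] (n : ℕ) :
    MultilinearMap k (fun _ : Fin n => A) A →ₗ[k]
      MultilinearMap k (fun _ : Fin (n + 1) => A) A :=
  hochschildFirstFace n +
    (∑ j : Fin n, (-1 : k) ^ ((j : ℕ) + 1) • hochschildInnerFace j) +
    (-1 : k) ^ (n + 1) • hochschildLastFace n

theorem hochschildDifferential_apply (n : ℕ) (φ : MultilinearMap k (fun _ : Fin n => A) A)
    (a : Fin (n + 1) → A) :
    hochschildDifferential k A n φ a = a 0 * φ (fun i => a i.succ) +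
      (∑ j : Fin n, (-1 : k) ^ ((j : ℕ) + 1) • φ (Fin.contractNth j.castSucc (· * ·) a)) +
      (-1 : k) ^ (n + 1) • (φ (fun i => a i.castSucc) * a (Fin.last n)) := by
  simp only [hochschildDifferential, LinearMap.add_apply, _root_.add_apply,
    LinearMap.sum_apply, _root_.sum_apply, LinearMap.smul_apply,
    _root_.smul_apply]
  rfl

end Hochschild

namespace TwistedGroupAlgebra

variable {G k : Type*} [Group G] [CommRing k] [Fintype G] (α : TwoCocycle G k)

/-- `Cⁿ(k_α G, k_α G)`. -/
abbrev Cochain (n : ℕ) : Type _ :=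
  MultilinearMap k (fun _ : Fin n => TwistedGroupAlgebra α) (TwistedGroupAlgebra α)

/-- The Hochschild cochain with prescribed values on the basis elements `ḡ₁ ⊗ … ⊗ ḡ_n`. -/
noncomputable def extend (n : ℕ) : ((Fin n → G) → TwistedGroupAlgebra α) →ₗ[k] Cochain α n where
  toFun f := ∑ g : Fin n → G,
    ((MultilinearMap.mkPiAlgebra k (Fin n) k).compLinearMap
      fun i => (basis α).coord (g i)).smulRight (f g)
  map_add' f f' := by
    ext
    simp [Finset.sum_add_distrib]
  map_smul' c f := by
    ext
    simp [Finset.smul_sum, smul_comm c]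

theorem extend_basis {n : ℕ} (f : (Fin n → G) → TwistedGroupAlgebra α) (g : Fin n → G) :
    extend α n f (fun i => basis α (g i)) = f g := by
  classical
  simp only [extend, LinearMap.coe_mk, AddHom.coe_mk, _root_.sum_apply,
    MultilinearMap.smulRight_apply, MultilinearMap.compLinearMap_apply,
    MultilinearMap.mkPiAlgebra_apply, Module.Basis.coord_apply, Module.Basis.repr_self]
  rw [Finset.sum_eq_single g]
  · simp
  · intro b _ hb
    obtain ⟨i, hi⟩ := Function.ne_iff.mp hb
    rw [Finset.prod_eq_zero (Finset.mem_univ i) (by simp [hi.symm]),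
      zero_smul]
  · simp

/-- The action of the transposition `σ_{i+1} = (i+1, i+2)` of `Σ_{n+1}` on `Cⁿ(k_α G, k_α G)`,
given on basis elements by
`(σ_i φ)(ḡ₁ ⊗ … ⊗ ḡ_n) = -φ(… ⊗ ḡ_{i-1} ḡ_i ⊗ ḡ_i⁻¹ ⊗ ḡ_i ḡ_{i+1} ⊗ …)`, with an additional left
factor `ḡ_1` if `i = 1` and an additional right factor `ḡ_n` if `i = n` (both if `i = n = 1`). -/
noncomputable def transposition {n : ℕ} (i : Fin n) : Cochain α n →ₗ[k] Cochain α n :=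
  extend α n ∘ₗ
    { toFun := fun φ g =>
        -((if (i : ℕ) = 0 then basis α (g i) else 1) *
          φ (fun j => ((swapTuple i (fun l => unit α (g l)) j : (TwistedGroupAlgebra α)ˣ) :
            TwistedGroupAlgebra α)) *
          (if (i : ℕ) + 1 = n then basis α (g i) else 1))
      map_add' := fun φ φ' => by
        ext1 g
        simp only [_root_.add_apply, mul_add, add_mul, neg_add, Pi.add_apply]
      map_smul' := fun c φ => by
        ext1 g
        simp only [_root_.smul_apply, mul_smul_comm, smul_mul_assoc, smul_neg,
          Pi.smul_apply, RingHom.id_apply] }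

/-- `CSⁿ(k_α G, k_α G)`: the Hochschild cochains fixed by `Σ_{n+1}`, that is, by its generating
transpositions. -/
noncomputable def symCochains (n : ℕ) : Submodule k (Cochain α n) :=
  ⨅ i : Fin n, LinearMap.eqLocus (transposition α i) LinearMap.id

/-- The cocycles of the symmetric Hochschild cochain complex `CS*(k_α G, k_α G)`. -/
noncomputable def symCocycles (n : ℕ) : Submodule k (Cochain α n) :=
  symCochains α n ⊓ LinearMap.ker (hochschildDifferential k (TwistedGroupAlgebra α) n)

/-- The coboundaries of the symmetric Hochschild cochain complex `CS*(k_α G, k_α G)`: the images of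
*symmetric* cochains. -/
noncomputable def symCoboundaries : (n : ℕ) → Submodule k (Cochain α n)
  | 0 => ⊥
  | n + 1 => (symCochains α n).map (hochschildDifferential k (TwistedGroupAlgebra α) n)

/-- The symmetric Hochschild cohomology `HHSⁿ(k_α G) = HHSⁿ(k_α G, k_α G)`. -/
abbrev HHS (n : ℕ) : Type _ :=
  symCocycles α n ⧸ (symCoboundaries α n).submoduleOf (symCocycles α n)

/-- The class of a symmetric Hochschild cocycle in `HHSⁿ(k_α G)`. -/
noncomputable abbrev HHS.mk (n : ℕ) : symCocycles α n →ₗ[k] HHS α n :=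
  Submodule.mkQ _

/-! ### The maps `ν` and `π` on cochains -/

/-- For `x ∈ Z(G)`, the map `ν^n_{G,x,α} : Cⁿ(G, k x̄) → Cⁿ(k_α G, k_α G)`,
`ν(ψ)(ḡ₁ ⊗ … ⊗ ḡ_n) = ψ(g₁, …, g_n) · ḡ₁ ⋯ ḡ_n`, where `a : k` stands for `a x̄`. -/
noncomputable def nuCentral (x : G) (n : ℕ) : ((Fin n → G) → k) →ₗ[k] Cochain α n :=
  extend α n ∘ₗ
    { toFun := fun ψ g => (ψ g • basis α x) * (List.ofFn fun i => basis α (g i)).prod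
      map_add' := fun ψ ψ' => by
        ext1 g
        simp only [Pi.add_apply, add_smul, add_mul]
      map_smul' := fun c ψ => by
        ext1 g
        simp only [Pi.smul_apply, smul_eq_mul, mul_smul, smul_mul_assoc, RingHom.id_apply] }

/-- The coefficient of `x̄` in `φ(h̄₁ ⊗ … ⊗ h̄_n) · h̄_n⁻¹ ⋯ h̄₁⁻¹`. -/
noncomputable def piCoeff (x : G) (n : ℕ) : Cochain α n →ₗ[k] ((Fin n → G) → k) where
  toFun φ h := (basis α).coord x (φ (fun i => basis α (h i)) *
    (((List.ofFn fun i => (unit α (h i))⁻¹).reverse.prod : (TwistedGroupAlgebra α)ˣ) :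
      TwistedGroupAlgebra α))
  map_add' φ φ' := by
    ext1 h
    simp only [_root_.add_apply, add_mul, map_add, Pi.add_apply]
  map_smul' c φ := by
    ext1 h
    simp only [_root_.smul_apply, smul_mul_assoc, map_smul, Pi.smul_apply, RingHom.id_apply]

/-- The map `π^n_{G,x,α} : Cⁿ(k_α G, k_α G) → Cⁿ(C_G(x), k x̄)`, where `a : k` stands for `a x̄`.
For `x ∈ Z(G)` the group `C_G(x)` is `G`, and the map is `piCoeff`. -/
noncomputable def piCentralizer (x : G) (n : ℕ) :
    Cochain α n →ₗ[k] ((Fin n → Subgroup.centralizer {x}) → k) :=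
  LinearMap.funLeft k k (fun h i => ((h i : Subgroup.centralizer {x}) : G)) ∘ₗ piCoeff α x n

end TwistedGroupAlgebra

/-- For a right transversal `T` of `H` (every element of `G` is uniquely `h t` with `h ∈ H`,
`t ∈ T`), and for `t ∈ G`, the elements `h₁, …, h_n ∈ H` determined by
`t g₁ = h₁ t₁`, `t₁ g₂ = h₂ t₂`, …, `t_{n-1} g_n = h_n t_n` with `t₁, …, t_n ∈ T`. -/
noncomputable def transversalSeq {G : Type*} [Group G] {H : Subgroup G} {T : Set G}
    (hT : Subgroup.IsComplement (H : Set G) T) : (n : ℕ) → G → (Fin n → G) → Fin n → H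
  | 0, _, _ => Fin.elim0
  | n + 1, t, g => Fin.cons (hT.equiv (t * g 0)).1
      (transversalSeq hT n (hT.equiv (t * g 0)).2 (fun i => g i.succ))

/-- The map `ν^n_{G,x} : Cⁿ(C_G(x), k) → Cⁿ(kG, kG)` attached to a right transversal `T` of
`C_G(x)` in `G`: `ν(ψ)(g₁ ⊗ … ⊗ g_n) = ∑_{t ∈ T} ψ(h_{t,1}, …, h_{t,n}) t⁻¹ x t g₁ ⋯ g_n`. -/
noncomputable def nuCentralizer {G : Type*} (k : Type*) [CommRing k] [Group G] [Fintype G]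
    {x : G} {T : Finset G}
    (hT : Subgroup.IsComplement (Subgroup.centralizer {x} : Set G) (T : Set G)) (n : ℕ) :
    ((Fin n → Subgroup.centralizer {x}) → k) →ₗ[k]
      TwistedGroupAlgebra.Cochain (TwoCocycle.trivial G k) n :=
  TwistedGroupAlgebra.extend (TwoCocycle.trivial G k) n ∘ₗ
    { toFun := fun ψ g => ∑ t ∈ T, ψ (transversalSeq hT n t g) •
        TwistedGroupAlgebra.basis (TwoCocycle.trivial G k) (t⁻¹ * x * t * (List.ofFn g).prod)
      map_add' := fun ψ ψ' => by
        ext1 g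
        simp only [Pi.add_apply, add_smul, Finset.sum_add_distrib]
      map_smul' := fun c ψ => by
        ext1 g
        simp only [Pi.smul_apply, smul_eq_mul, mul_smul, Finset.smul_sum, RingHom.id_apply] }

/-! ### Edge tuples -/

/-! Two changes of viewpoint reduce the theorem to identities between cochains.

Untwisting. Send a Hochschild cochain `φ` to `(g₁, …, g_n) ↦ φ(ḡ₁ ⊗ … ⊗ ḡ_n) (ḡ₁ ⋯ ḡ_n)⁻¹`. This is
an injective map to the group cochains of `G` with coefficients in `k_α G` under conjugation. It
intertwines both the differentials and the transpositions (`groupDifferential_untwist`,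
`groupTransposition_untwist`). The values of `α` disappear because numerator and denominator are
rescaled by the same scalar (`unitsCochain_congr`). Conjugation permutes the lines `k ȳ`. For
central `x` the line `k x̄` is stable, `ν` is induced by its inclusion and `π` by the coefficient
functional at `x̄`, both equivariant. For trivial `α` the class of `x` spans a module coinduced from
the trivial module of `C_G(x)`. Then `ν` is an explicit Shapiro map (`coinduce`), and `π` is
restriction to `C_G(x)` followed by the coefficient at `x`.

Vertices. Regard `(g₁, …, g_n)` as the edges of a path with vertices `1, g₁, g₁g₂, …`. The
differential deletes vertices and `σ_i` exchanges two neighbouring ones, so every construction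
defined vertex by vertex respects both. The elements `h_{t,i}` are of this kind: they are the edges
between the `C_G(x)`-components of the vertices `t g₁ ⋯ g_j`.

Already on cochains `π_x ν_x = id`, and `π_x ν_y = 0` for `x ≠ y`. As all maps preserve symmetric
cocycles and coboundaries, this passes to cohomology (`exists_split_injection`). -/

section Edges

variable {H : Type*} [Group H] {n : ℕ}

/-- The tuple of quotients of consecutive entries. -/
def edges (Q : Fin (n + 1) → H) : Fin n → H := fun j => (Q j.castSucc)⁻¹ * Q j.succ

theorem edges_partialProd (g : Fin n → H) : edges (Fin.partialProd g) = g :=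
  funext (Fin.partialProd_right_inv g)

theorem partialProd_edges (Q : Fin (n + 1) → H) (j : Fin (n + 1)) :
    Fin.partialProd (edges Q) j = (Q 0)⁻¹ * Q j :=
  eq_inv_mul_of_mul_eq (congrFun (Fin.partialProd_left_inv Q) j)

theorem edges_mul_left (c : H) (Q : Fin (n + 1) → H) : edges (fun j => c * Q j) = edges Q := by
  ext j
  simp [edges, mul_assoc]

/-- Merging two neighbouring edges forgets the vertex between them, and `j = n` forgets the end
vertex. Vertex `0` never occurs here: its deletion is the separate first term of the differential.
-/
theorem contractNth_edges (Q : Fin (n + 2) → H) (j : Fin (n + 1)) :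
    Fin.contractNth j (· * ·) (edges Q) = edges (Q ∘ j.succ.succAbove) := by
  rw [← edges_partialProd (Fin.contractNth j (· * ·) (edges Q)), Fin.partialProd_contractNth,
    ← edges_mul_left (Q 0)⁻¹ (Q ∘ _)]
  congr 1
  ext i
  simp [partialProd_edges]

/-- The three special entries of `swapTuple` are the edges meeting one of the two exchanged
vertices; the edge joining them is reversed. -/
theorem swapTuple_edges (Q : Fin (n + 1) → H) (i : Fin n) :
    swapTuple i (edges Q) = edges (Q ∘ Equiv.swap i.castSucc i.succ) := by
  ext j
  rcases i with ⟨i, hi⟩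
  rcases j with ⟨j, hj⟩
  simp only [swapTuple, edges, Function.comp_apply, Equiv.swap_apply_def, Fin.ext_iff,
    Fin.castSucc_mk, Fin.succ_mk]
  by_cases h1 : j + 1 = i
  · subst h1
    simp [mul_assoc, show j ≠ j + 1 + 1 by omega]
  by_cases h2 : j = i
  · subst h2
    simp
  by_cases h3 : j = i + 1
  · subst h3
    simp [mul_assoc, show i + 1 + 1 ≠ i by omega]
  have h4 : j + 1 ≠ i + 1 := by omega
  simp [h1, h2, h3]

/-- Partial products normalize vertex `0` to `1`. Exchanging vertices `0` and `1` breaks this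
normalization, and the left factor `g i` repairs it. Hence the extra factor in the action of the
first transposition. -/
theorem partialProd_swapTuple (g : Fin n → H) (i : Fin n) (j : Fin (n + 1)) :
    (if (i : ℕ) = 0 then g i else 1) * Fin.partialProd (swapTuple i g) j =
      Fin.partialProd g (Equiv.swap i.castSucc i.succ j) := by
  conv_lhs => rw [← edges_partialProd g, swapTuple_edges, partialProd_edges, edges_partialProd]
  rw [← mul_assoc]
  simp only [Function.comp_apply]
  refine mul_eq_right.mpr (mul_inv_eq_one.mpr ?_)
  split_ifs with h
  · have : i.castSucc = 0 := Fin.ext h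
    rw [← this, Equiv.swap_apply_left, Fin.partialProd_succ, this, Fin.partialProd_zero, one_mul]
  · rw [Equiv.swap_apply_of_ne_of_ne, Fin.partialProd_zero]
    · exact fun h' => h (by simpa using (congrArg Fin.val h').symm)
    · exact (Fin.succ_ne_zero i).symm

theorem partialProd_last (g : Fin n → H) : Fin.partialProd g (Fin.last n) = (List.ofFn g).prod := by
  rw [Fin.partialProd, List.take_of_length_le (by simp)]

/-- The total product is the last vertex, which moves only under the last transposition; the right
factor compensates. These are exactly the end factors of the Hochschild action. -/
theorem prod_swapTuple (g : Fin n → H) (i : Fin n) :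
    (if (i : ℕ) = 0 then g i else 1) * (List.ofFn (swapTuple i g)).prod *
      (if (i : ℕ) + 1 = n then g i else 1) = (List.ofFn g).prod := by
  simp only [← partialProd_last, partialProd_swapTuple]
  split_ifs with h
  · have : i.succ = Fin.last n := Fin.ext h
    rw [← this, Equiv.swap_apply_right, Fin.partialProd_succ]
  · rw [Equiv.swap_apply_of_ne_of_ne, mul_one]
    · exact (Fin.castSucc_lt_last i).ne'
    · exact fun h' => h (by simpa using (congrArg Fin.val h').symm)

theorem prod_contractNth (g : Fin (n + 1) → H) (j : Fin n) :
    (List.ofFn (Fin.contractNth j.castSucc (· * ·) g)).prod = (List.ofFn g).prod := by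
  rw [← partialProd_last, ← partialProd_last, Fin.partialProd_contractNth, Function.comp_apply,
    ← Fin.castSucc_succ, Fin.succAbove_of_le_castSucc _ _ (by simp), Fin.succ_last]

theorem comp_swapTuple {K : Type*} [Group K] (f : H →* K) (i : Fin n) (g : Fin n → H) :
    (fun j => f (swapTuple i g j)) = swapTuple i (fun j => f (g j)) := by
  ext j
  simp only [swapTuple]
  split_ifs <;> simp

theorem contractNth_last {A : Type*} (op : A → A → A) (g : Fin (n + 1) → A) :
    Fin.contractNth (Fin.last n) op g = fun j => g j.castSucc := by
  ext j
  exact Fin.contractNth_apply_of_lt _ _ _ _ j.2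

end Edges

/-! ### Functoriality of group cochains -/

section Functoriality

variable {k G H A B : Type*} [CommRing k] [Group G] [Group H] [AddCommGroup A] [Module k A]
  [AddCommGroup B] [Module k B]

theorem groupDifferential_apply (ρ : Representation k G A) {n : ℕ} (f : (Fin n → G) → A)
    (g : Fin (n + 1) → G) :
    groupDifferential ρ n f g = ρ (g 0) (f fun i => g i.succ) +
      ∑ j : Fin (n + 1), (-1 : k) ^ ((j : ℕ) + 1) • f (Fin.contractNth j (· * ·) g) := rfl

theorem groupTransposition_apply (ρ : Representation k G A) {n : ℕ} (i : Fin n)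
    (f : (Fin n → G) → A) (g : Fin n → G) :
    groupTransposition ρ i f g = -(ρ (if (i : ℕ) = 0 then g i else 1) (f (swapTuple i g))) := rfl

/-- Functoriality for a compatible pair of a group homomorphism and a coefficient map. It is applied
with the identity of `G` for central `x`, and with the inclusion of `C_G(x)` for `π`. -/
theorem groupDifferential_comp {ρ : Representation k G A} {σ : Representation k H B} (ι : H →* G)
    (L : A →ₗ[k] B) (hL : ∀ h a, L (ρ (ι h) a) = σ h (L a)) {n : ℕ} (f : (Fin n → G) → A) :
    groupDifferential σ n (fun h => L (f fun i => ι (h i))) =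
      fun h => L (groupDifferential ρ n f fun i => ι (h i)) := by
  ext h
  simp only [groupDifferential_apply, map_add, hL, map_sum, map_smul]
  congr 1
  refine Finset.sum_congr rfl fun j _ => ?_
  have := Fin.comp_contractNth (· * ·) (· * ·) (f := ι) (fun a b => map_mul ι a b) j h
  simp only [Function.comp_def] at this
  rw [this]

theorem groupTransposition_comp {ρ : Representation k G A} {σ : Representation k H B} (ι : H →* G)
    (L : A →ₗ[k] B) (hL : ∀ h a, L (ρ (ι h) a) = σ h (L a)) {n : ℕ} (i : Fin n)
    (f : (Fin n → G) → A) :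
    groupTransposition σ i (fun h => L (f fun i => ι (h i))) =
      fun h => L (groupTransposition ρ i f fun i => ι (h i)) := by
  ext h
  simp only [groupTransposition_apply, map_neg]
  rw [comp_swapTuple, ← hL]
  congr 4
  split_ifs <;> simp

end Functoriality

/-! ### Hochschild cochains as group cochains of the unit group -/

section Units

variable (k : Type*) {A : Type*} [CommRing k] [Ring A] [Algebra k A]

/-- The conjugation representation of `Aˣ` on `A`. -/
def unitsConj : Representation k Aˣ A where
  toFun u := LinearMap.mulLeft k (u : A) ∘ₗ LinearMap.mulRight k ((u⁻¹ : Aˣ) : A)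
  map_one' := by ext; simp
  map_mul' u v := by ext; simp [mul_assoc]

theorem unitsConj_apply (u : Aˣ) (a : A) : unitsConj k u a = u * a * ((u⁻¹ : Aˣ) : A) := by
  simp [unitsConj, mul_assoc]

variable {k}

/-- The value of a Hochschild cochain at a tuple of units, divided by their product. -/
def unitsCochain {n : ℕ} (φ : MultilinearMap k (fun _ : Fin n => A) A) (u : Fin n → Aˣ) : A :=
  φ (fun i => (u i : A)) * (((List.ofFn u).prod⁻¹ : Aˣ) : A)

/-- Inner faces do not change the total product. Dividing by it turns left multiplication in the
first face into conjugation and cancels the right factor of the last face. -/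
theorem groupDifferential_unitsCochain {n : ℕ} (φ : MultilinearMap k (fun _ : Fin n => A) A) :
    groupDifferential (unitsConj k) n (unitsCochain φ) =
      unitsCochain (hochschildDifferential k A n φ) := by
  ext u
  rw [groupDifferential_apply, Fin.sum_univ_castSucc, unitsConj_apply]
  simp only [unitsCochain, hochschildDifferential_apply, add_mul, add_assoc, Finset.sum_mul,
    smul_mul_assoc, prod_contractNth, contractNth_last, Fin.val_castSucc, Fin.val_last]
  congr 1
  · rw [List.ofFn_succ, List.prod_cons, mul_inv_rev]
    simp [mul_assoc]
  congr 1
  · refine Finset.sum_congr rfl fun j _ => ?_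
    have := Fin.comp_contractNth (· * ·) (· * ·) (f := fun x : Aˣ => (x : A))
      (fun a b => Units.val_mul a b) j.castSucc u
    simp only [Function.comp_def] at this
    rw [this]
  · rw [List.ofFn_succ', List.concat_eq_append, List.prod_append, List.prod_singleton, mul_inv_rev]
    simp [mul_assoc]

theorem groupTransposition_unitsCochain {n : ℕ} (i : Fin n)
    (φ : MultilinearMap k (fun _ : Fin n => A) A) (u : Fin n → Aˣ) :
    groupTransposition (unitsConj k) i (unitsCochain φ) u =
      -((if (i : ℕ) = 0 then (u i : A) else 1) * φ (fun j => ((swapTuple i u j : Aˣ) : A)) *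
        (if (i : ℕ) + 1 = n then (u i : A) else 1)) * (((List.ofFn u).prod⁻¹ : Aˣ) : A) := by
  rw [groupTransposition_apply, unitsConj_apply, unitsCochain, neg_mul, neg_inj,
    ← prod_swapTuple u i]
  have e (p : Prop) [Decidable p] : (if p then (u i : A) else 1) =
      ((if p then u i else 1 : Aˣ) : A) := by
    split_ifs <;> simp
  rw [e, e]
  generalize (if (i : ℕ) = 0 then u i else 1) = a
  generalize (if (i : ℕ) + 1 = n then u i else 1) = b
  simp [mul_assoc]

/-- `unitsCochain φ` only depends on its arguments up to scalar units. -/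
theorem unitsCochain_congr {n : ℕ} (φ : MultilinearMap k (fun _ : Fin n => A) A) {u v : Fin n → Aˣ}
    (h : ∀ i, ∃ c : k, (u i : A) = c • (v i : A)) : unitsCochain φ u = unitsCochain φ v := by
  choose c hc using h
  have hp : (((List.ofFn u).prod : Aˣ) : A) = (∏ i, c i) • (((List.ofFn v).prod : Aˣ) : A) := by
    clear φ
    induction n with
    | zero => simp
    | succ n ih =>
      rw [List.ofFn_succ, List.ofFn_succ, List.prod_cons, List.prod_cons, Units.val_mul, hc,
        Units.val_mul, ih (fun i => c i.succ) (fun i => hc i.succ), Fin.prod_univ_succ,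
        smul_mul_smul_comm]
  unfold unitsCochain
  -- Cross-multiplying leaves the scalar `∏ c i` on both sides, so the `c i` need not be known to be
  -- invertible.
  rw [Units.mul_inv_eq_iff_eq_mul, hp, mul_smul_comm, Units.inv_mul_cancel_right]
  simp only [hc, MultilinearMap.map_smul_univ]

end Units
/-! ### Hochschild cochains of twisted group algebras as group cochains -/

namespace TwistedGroupAlgebra

section Untwist

variable {G k : Type*} [Group G] [CommRing k] (α : TwoCocycle G k)

theorem val_unit (g : G) : (unit α g : TwistedGroupAlgebra α) = basis α g := rfl

theorem val_inv_unit (g : G) : (((unit α g)⁻¹ : (TwistedGroupAlgebra α)ˣ) : TwistedGroupAlgebra α) =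
    (((α 1 1)⁻¹ * (α g g⁻¹)⁻¹ : kˣ) : k) • basis α g⁻¹ := rfl

theorem unitsConj_unit_basis (g y : G) : unitsConj k (unit α g) (basis α y) =
    ((α g y * (α (g * y * g⁻¹) g)⁻¹ : kˣ) : k) • basis α (g * y * g⁻¹) := by
  rw [unitsConj_apply, Units.mul_inv_eq_iff_eq_mul, val_unit, basis_mul_basis, smul_mul_assoc,
    basis_mul_basis, smul_smul, ← Units.val_mul]
  simp

/-- The conjugation representation of `G` on `k_α G`. -/
noncomputable def conj : Representation k G (TwistedGroupAlgebra α) where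
  toFun g := unitsConj k (unit α g)
  map_one' := by
    refine (basis α).ext fun y => ?_
    rw [unitsConj_unit_basis]
    simp [α.one_left y, α.one_right y]
  map_mul' g h := by
    rw [← map_mul]
    refine LinearMap.ext fun a => ?_
    rw [unitsConj_apply, unitsConj_apply, Units.mul_inv_eq_iff_eq_mul]
    -- The basis elements multiply only up to a scalar, but scalars cancel in conjugation, so the
    -- action is a genuine representation.
    have e : (unit α (g * h) : TwistedGroupAlgebra α) =
        (((α g h)⁻¹ : kˣ) : k) • ((unit α g * unit α h : (TwistedGroupAlgebra α)ˣ) :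
          TwistedGroupAlgebra α) := by
      rw [Units.val_mul, val_unit, val_unit, val_unit, basis_mul_basis, smul_smul]
      simp
    rw [e, mul_smul_comm, Units.inv_mul_cancel_right, smul_mul_assoc]

theorem conj_basis (g y : G) : conj α g (basis α y) =
    ((α g y * (α (g * y * g⁻¹) g)⁻¹ : kˣ) : k) • basis α (g * y * g⁻¹) :=
  unitsConj_unit_basis α g y

/-- The cochain `(g₁, …, g_n) ↦ φ(ḡ₁ ⊗ … ⊗ ḡ_n) · (ḡ₁ ⋯ ḡ_n)⁻¹`. -/
noncomputable def untwist {n : ℕ} (φ : Cochain α n) (g : Fin n → G) : TwistedGroupAlgebra α :=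
  unitsCochain φ fun i => unit α (g i)

theorem untwist_apply {n : ℕ} (φ : Cochain α n) (g : Fin n → G) : untwist α φ g =
    φ (fun i => basis α (g i)) * (((List.ofFn fun i => unit α (g i)).prod⁻¹ :
      (TwistedGroupAlgebra α)ˣ) : TwistedGroupAlgebra α) := rfl

/-- This allows identities between Hochschild cochains to be checked after untwisting, as needed for
both maps `ν`. -/
theorem untwist_injective (n : ℕ) :
    Function.Injective (untwist α : Cochain α n → (Fin n → G) → TwistedGroupAlgebra α) := by
  intro φ φ' h
  refine Module.Basis.ext_multilinear (fun _ => basis α) fun g => ?_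
  have := congrFun h g
  rwa [untwist_apply, untwist_apply, Units.mul_left_inj] at this

theorem groupDifferential_untwist {n : ℕ} (φ : Cochain α n) :
    groupDifferential (conj α) n (untwist α φ) =
      untwist α (hochschildDifferential k (TwistedGroupAlgebra α) n φ) := by
  ext1 g
  refine Eq.trans ?_ (congrFun (groupDifferential_unitsCochain φ) fun i => unit α (g i))
  rw [groupDifferential_apply, groupDifferential_apply]
  congr 1
  -- The two contracted tuples differ only where `unit α (g * h)` faces `unit α g * unit α h`, hence
  -- by scalars.
  refine Finset.sum_congr rfl fun j _ => congrArg _ (unitsCochain_congr φ fun i => ?_)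
  simp only [Fin.contractNth]
  split_ifs
  · exact ⟨1, by simp⟩
  · refine ⟨(((α (g i.castSucc) (g i.succ))⁻¹ : kˣ) : k), ?_⟩
    rw [Units.val_mul, val_unit, val_unit, val_unit, basis_mul_basis, smul_smul]
    simp
  · exact ⟨1, by simp⟩

theorem piCoeff_eq (x : G) {n : ℕ} (φ : Cochain α n) :
    piCoeff α x n φ = fun g => (basis α).coord x (untwist α φ g) := by
  ext1 g
  simp only [piCoeff, LinearMap.coe_mk, AddHom.coe_mk, untwist_apply]
  rw [List.prod_inv_reverse, List.map_ofFn]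
  rfl

/-- The coefficient of `x̄` is equivariant for elements commuting with `x`. -/
theorem coord_conj {x g : G} (h : g * x = x * g) (a : TwistedGroupAlgebra α) :
    (basis α).coord x (conj α g a) = ((α g x * (α x g)⁻¹ : kˣ) : k) * (basis α).coord x a := by
  refine LinearMap.congr_fun (f := (basis α).coord x ∘ₗ conj α g)
    (g := ((α g x * (α x g)⁻¹ : kˣ) : k) • (basis α).coord x) ((basis α).ext fun y => ?_) a
  have hx : g * x * g⁻¹ = x := by rw [h, mul_inv_cancel_right]
  rw [LinearMap.comp_apply, conj_basis, map_smul, LinearMap.smul_apply]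
  simp only [Module.Basis.coord_apply, Module.Basis.repr_self, smul_eq_mul]
  by_cases hy : y = x
  · rw [hy, hx]
  · have : g * y * g⁻¹ ≠ x := fun h' => hy (by
      rw [← hx] at h'
      simpa using h')
    rw [Finsupp.single_eq_of_ne' this, Finsupp.single_eq_of_ne' hy, mul_zero, mul_zero]

theorem smul_basis_conj {x g : G} (h : g * x = x * g) (a : k) :
    conj α g (a • basis α x) = (((α g x * (α x g)⁻¹ : kˣ) : k) * a) • basis α x := by
  have hx : g * x * g⁻¹ = x := by rw [h, mul_inv_cancel_right]
  rw [map_smul, conj_basis, hx, smul_smul, mul_comm]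

variable [Fintype G]

theorem untwist_extend {n : ℕ} (f : (Fin n → G) → TwistedGroupAlgebra α) (g : Fin n → G) :
    untwist α (extend α n f) g = f g * (((List.ofFn fun i => unit α (g i)).prod⁻¹ :
      (TwistedGroupAlgebra α)ˣ) : TwistedGroupAlgebra α) := by
  rw [untwist_apply, extend_basis]

theorem transposition_apply {n : ℕ} (i : Fin n) (φ : Cochain α n) :
    transposition α i φ = extend α n fun g =>
      -((if (i : ℕ) = 0 then (unit α (g i) : TwistedGroupAlgebra α) else 1) *
          φ (fun j => ((swapTuple i (fun l => unit α (g l)) j : (TwistedGroupAlgebra α)ˣ) :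
            TwistedGroupAlgebra α)) *
          (if (i : ℕ) + 1 = n then (unit α (g i) : TwistedGroupAlgebra α) else 1)) := rfl

theorem groupTransposition_untwist {n : ℕ} (i : Fin n) (φ : Cochain α n) :
    groupTransposition (conj α) i (untwist α φ) = untwist α (transposition α i φ) := by
  ext1 g
  rw [transposition_apply, untwist_extend,
    ← groupTransposition_unitsCochain i φ fun i => unit α (g i),
    groupTransposition_apply, groupTransposition_apply]
  have e : conj α (if (i : ℕ) = 0 then g i else 1) =
      unitsConj k (if (i : ℕ) = 0 then unit α (g i) else 1) := by
    split_ifs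
    · rfl
    · rw [map_one, map_one]
  rw [e]
  congr 2
  refine unitsCochain_congr φ fun j => ?_
  have e (a b : G) : ∃ c : k, (unit α (a * b) : TwistedGroupAlgebra α) =
      c • ((unit α a * unit α b : (TwistedGroupAlgebra α)ˣ) : TwistedGroupAlgebra α) := by
    refine ⟨(((α a b)⁻¹ : kˣ) : k), ?_⟩
    rw [Units.val_mul, val_unit, val_unit, val_unit, basis_mul_basis, smul_smul]
    simp
  simp only [swapTuple]
  split_ifs
  · exact e _ _
  -- The scalar is the inverse of the coefficient in `val_inv_unit`.
  · refine ⟨((α 1 1 * α (g i) (g i)⁻¹ : kˣ) : k), ?_⟩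
    rw [val_inv_unit, smul_smul, ← Units.val_mul, val_unit, mul_mul_mul_comm, mul_inv_cancel,
      mul_inv_cancel, mul_one, Units.val_one, one_smul]
  · exact e _ _
  · exact ⟨1, by simp⟩

/-! ### The maps `ν` and `π` in terms of group cochains -/

theorem untwist_nuCentral (x : G) {n : ℕ} (ψ : (Fin n → G) → k) :
    untwist α (nuCentral α x n ψ) = fun g => ψ g • basis α x := by
  ext1 g
  refine (untwist_extend α _ g).trans ?_
  rw [Units.mul_inv_eq_iff_eq_mul]
  simp only [LinearMap.coe_mk, AddHom.coe_mk]
  rw [← Units.coeHom_apply, map_list_prod, List.map_ofFn]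
  rfl

end Untwist

end TwistedGroupAlgebra
/-! ### Transversals -/

section Transversal

variable {G : Type*} [Group G] {H : Subgroup G} {T : Set G}
  (hT : Subgroup.IsComplement (H : Set G) T)

/-- The component in `H` of an element of `G`. -/
noncomputable def transversalPart (g : G) : H := (hT.equiv g).1

theorem transversalPart_mul_left (h : H) (g : G) :
    transversalPart hT (h * g) = h * transversalPart hT g :=
  congrArg Prod.fst (hT.equiv_mul_left h g)

theorem transversalPart_of_mem {t : G} (ht : t ∈ T) : transversalPart hT t = 1 :=
  hT.equiv_fst_eq_one_of_mem_of_one_mem H.one_mem ht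

theorem transversalPart_mul_snd (g : G) : transversalPart hT g * ((hT.equiv g).2 : G) = g :=
  hT.equiv_fst_mul_equiv_snd g

/-- The tuple `(h₁, …, h_n)` determined by `t g₁ ⋯ g_j ∈ h₀ h₁ ⋯ h_j T` for `0 ≤ j ≤ n`. -/
noncomputable def cosetSeq {n : ℕ} (t : G) (g : Fin n → G) : Fin n → H :=
  edges fun j => transversalPart hT (t * Fin.partialProd g j)

theorem cosetSeq_mul_left (h : H) (t : G) {n : ℕ} (g : Fin n → G) :
    cosetSeq hT (h * t) g = cosetSeq hT t g := by
  simp only [cosetSeq, mul_assoc, transversalPart_mul_left, edges_mul_left]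

theorem cosetSeq_succ (t : G) {n : ℕ} (g : Fin (n + 1) → G) :
    (fun j => cosetSeq hT t g j.succ) = cosetSeq hT (t * g 0) fun j => g j.succ := by
  ext j
  simp only [cosetSeq, edges]
  rw [← Fin.succ_castSucc, Fin.partialProd_succ', Fin.partialProd_succ', mul_assoc, mul_assoc]
  rfl

theorem cosetSeq_contractNth (t : G) {n : ℕ} (g : Fin (n + 1) → G) (j : Fin (n + 1)) :
    cosetSeq hT t (Fin.contractNth j (· * ·) g) =
      Fin.contractNth j (· * ·) (cosetSeq hT t g) := by
  rw [cosetSeq, cosetSeq, contractNth_edges, Fin.partialProd_contractNth]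
  rfl

/-- The first transposition moves the base vertex, so the base point `t` must be shifted by `(g
i)⁻¹`; otherwise it stays. -/
theorem cosetSeq_swapTuple (t : G) {n : ℕ} (g : Fin n → G) (i : Fin n) :
    cosetSeq hT t (swapTuple i g) =
      swapTuple i (cosetSeq hT (t * (if (i : ℕ) = 0 then g i else 1)⁻¹) g) := by
  rw [cosetSeq, cosetSeq, swapTuple_edges]
  congr 1
  ext1 j
  rw [Function.comp_apply, ← partialProd_swapTuple, ← mul_assoc, inv_mul_cancel_right]

theorem transversalSeq_eq_cosetSeq {n : ℕ} {t : G} (ht : t ∈ T) (g : Fin n → G) :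
    transversalSeq hT n t g = cosetSeq hT t g := by
  induction n generalizing t with
  | zero => exact Subsingleton.elim _ _
  | succ n ih =>
    ext1 j
    refine Fin.cases ?_ (fun j => ?_) j
    · simp only [transversalSeq, Fin.cons_zero, cosetSeq, edges, Fin.castSucc_zero,
        Fin.partialProd_zero, mul_one, transversalPart_of_mem hT ht, inv_one, one_mul,
        Fin.partialProd_succ]
      rfl
    · simp only [transversalSeq, Fin.cons_succ]
      -- The recursion restarts at the representative of `t * g 0`, which differs from `t * g 0` by
      -- a left factor in `H`; `cosetSeq` does not see it.
      rw [ih (hT.equiv (t * g 0)).2.2, ← cosetSeq_mul_left hT (transversalPart hT (t * g 0)),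
        transversalPart_mul_snd, ← cosetSeq_succ]

theorem cosetSeq_one (hT1 : (1 : G) ∈ T) {n : ℕ} (h : Fin n → H) :
    cosetSeq hT 1 (fun i => (h i : G)) = h := by
  have e (j) : Fin.partialProd (fun i => (h i : G)) j = ((Fin.partialProd h j : H) : G) := by
    refine Fin.inductionOn j (by simp) fun j hj => ?_
    rw [Fin.partialProd_succ, Fin.partialProd_succ, hj, Subgroup.coe_mul]
  conv_rhs => rw [← edges_partialProd h]
  unfold cosetSeq
  congr 1
  ext1 j
  rw [one_mul, e, ← mul_one ((Fin.partialProd h j : H) : G), transversalPart_mul_left,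
    transversalPart_of_mem hT hT1, mul_one]

theorem eq_one_of_mem_transversal (hT : Subgroup.IsComplement (H : Set G) T) (hT1 : (1 : G) ∈ T) {t : G} (ht : t ∈ T) (h : t ∈ H) :
    t = 1 := by
  have := hT.equiv_fst_eq_self_of_mem_of_one_mem hT1 h
  exact congrArg Subtype.val (this.symm.trans (transversalPart_of_mem hT ht))

/-- A sum over a transversal does not depend on the transversal. -/
theorem sum_transversal_mul_right {M : Type*} [AddCommMonoid M] {T : Finset G}
    (hT : Subgroup.IsComplement (H : Set G) (T : Set G)) (F : G → M)
    (hF : ∀ (h : H) (t : G), F (h * t) = F t) (g : G) : ∑ t ∈ T, F (t * g) = ∑ t ∈ T, F t := by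
  -- Right multiplication permutes the cosets `H t`. Taking `(a, b)` to be `(g, g⁻¹)` and `(g⁻¹, g)`
  -- gives the two inverse laws of the bijection on `T`.
  have key (a b t : G) (hab : a * b = 1) (ht : t ∈ T) :
      ((hT.equiv (((hT.equiv (t * a)).2 : G) * b)).2 : G) = t := by
    have h1 : ((hT.equiv (t * a)).2 : G) * b = ((transversalPart hT (t * a))⁻¹ : H) * t := by
      have h2 : t = t * a * b := by rw [mul_assoc, hab, mul_one]
      rw [eq_inv_mul_of_mul_eq (transversalPart_mul_snd hT (t * a)), mul_assoc, ← h2,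
        Subgroup.coe_inv]
    rw [h1, hT.equiv_mul_left,
      hT.equiv_snd_eq_self_of_mem_of_one_mem H.one_mem ht]
  refine Finset.sum_bij' (fun t _ => ((hT.equiv (t * g)).2 : G))
    (fun t _ => ((hT.equiv (t * g⁻¹)).2 : G)) (fun t _ => (hT.equiv (t * g)).2.2)
    (fun t _ => (hT.equiv (t * g⁻¹)).2.2) (fun t ht => key _ _ t (by simp) ht)
    (fun t ht => key _ _ t (by simp) ht) (fun t _ => ?_)
  conv_lhs => rw [← transversalPart_mul_snd hT (t * g)]
  exact hF _ _

end Transversal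

/-! ### The map `ν` of a centralizer in terms of group cochains -/

section Centralizer

variable {G k : Type*} [Group G] [CommRing k]

open TwistedGroupAlgebra

theorem conj_trivial_basis (g y : G) : conj (TwoCocycle.trivial G k) g (basis _ y) =
    basis (TwoCocycle.trivial G k) (g * y * g⁻¹) := by
  rw [conj_basis]
  change ((1 * 1⁻¹ : kˣ) : k) • _ = _
  rw [mul_inv_cancel, Units.val_one, one_smul]

theorem basis_mul_prod_unit (y : G) (l : List G) :
    basis (TwoCocycle.trivial G k) y * (((l.map (unit (TwoCocycle.trivial G k))).prod :
      (TwistedGroupAlgebra (TwoCocycle.trivial G k))ˣ) :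
        TwistedGroupAlgebra (TwoCocycle.trivial G k)) = basis _ (y * l.prod) := by
  induction l generalizing y with
  | nil => simp
  | cons a l ih =>
    rw [List.map_cons, List.prod_cons, List.prod_cons, Units.val_mul, ← mul_assoc, val_unit,
      basis_mul_basis, ← mul_assoc, ← ih]
    congr 1
    exact one_smul k _

variable (k) {x : G} {T : Finset G}
  (hT : Subgroup.IsComplement (Subgroup.centralizer {x} : Set G) (T : Set G))

/-- The group cochain `(g₁, …, g_n) ↦ ∑_{t ∈ T} ψ(h_{t,1}, …, h_{t,n}) t⁻¹ x t`. -/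
noncomputable def coinduce {n : ℕ} (ψ : (Fin n → Subgroup.centralizer {x}) → k) (g : Fin n → G) :
    TwistedGroupAlgebra (TwoCocycle.trivial G k) :=
  ∑ t ∈ T, ψ (cosetSeq hT t g) • basis (TwoCocycle.trivial G k) (t⁻¹ * x * t)

theorem untwist_nuCentralizer [Fintype G] {n : ℕ}
    (ψ : (Fin n → Subgroup.centralizer {x}) → k) :
    untwist _ (nuCentralizer k hT n ψ) = coinduce k hT ψ := by
  ext1 g
  refine (untwist_extend _ _ g).trans ?_
  rw [Units.mul_inv_eq_iff_eq_mul, coinduce, Finset.sum_mul]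
  refine Finset.sum_congr rfl fun t ht => ?_
  rw [transversalSeq_eq_cosetSeq hT ht, smul_mul_assoc, ← basis_mul_prod_unit, List.map_ofFn]
  rfl

variable {k} in
theorem conj_mul_inv (h : Subgroup.centralizer {x}) (t : G) :
    (h * t : G)⁻¹ * x * (h * t) = t⁻¹ * x * t := by
  have : x * h = h * x := (Subgroup.mem_centralizer_singleton_iff.mp h.2).symm
  calc (h * t : G)⁻¹ * x * (h * t) = t⁻¹ * (h : G)⁻¹ * (x * h) * t := by group
    _ = _ := by rw [this]; group

/-- Conjugation by `g` undoes the substitution of `t * g` for `t` in `t⁻¹ x t`. The substitution is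
legitimate because `F t` and `t⁻¹ x t` depend only on the coset `C_G(x) t`. -/
theorem sum_conj_coinduce
    (hT : Subgroup.IsComplement (Subgroup.centralizer {x} : Set G) (T : Set G)) (g : G) (F : G → k)
    (hF : ∀ (h : Subgroup.centralizer {x}) (t : G), F (h * t) = F t) :
    conj (TwoCocycle.trivial G k) g (∑ t ∈ T, F t • basis (TwoCocycle.trivial G k) (t⁻¹ * x * t)) =
      ∑ t ∈ T, F (t * g) • basis (TwoCocycle.trivial G k) (t⁻¹ * x * t) := by
  have := sum_transversal_mul_right hT
    (fun t => F t • basis (TwoCocycle.trivial G k) (g * (t⁻¹ * x * t) * g⁻¹))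
    (fun h t => by simp only [hF, conj_mul_inv]) g
  simp only [map_sum, map_smul, conj_trivial_basis]
  rw [← this]
  refine Finset.sum_congr rfl fun t _ => ?_
  congr 2
  group

/-- Contracted terms match for each `t` separately. In the first term, conjugation by `g 0`
reindexes the sum by `t * g 0`, the base point left after dropping the first vertex. -/
theorem groupDifferential_coinduce {n : ℕ} (ψ : (Fin n → Subgroup.centralizer {x}) → k) :
    groupDifferential (conj (TwoCocycle.trivial G k)) n (coinduce k hT ψ) =
      coinduce k hT (groupDifferential (Representation.trivial k _ k) n ψ) := by
  ext1 g
  rw [groupDifferential_apply]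
  simp only [coinduce, groupDifferential_apply, Representation.trivial_apply, add_smul,
    Finset.sum_add_distrib, Finset.sum_smul, cosetSeq_contractNth, Finset.smul_sum, cosetSeq_succ]
  rw [sum_conj_coinduce k hT (g 0) (fun t => ψ (cosetSeq hT t fun i => g i.succ))
    (fun h t => by rw [cosetSeq_mul_left]), Finset.sum_comm (s := T)]
  simp only [smul_assoc]

/-- The reindexing caused by conjugation cancels the shift of base point in `cosetSeq_swapTuple`. -/
theorem groupTransposition_coinduce {n : ℕ} (i : Fin n)
    (ψ : (Fin n → Subgroup.centralizer {x}) → k) :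
    groupTransposition (conj (TwoCocycle.trivial G k)) i (coinduce k hT ψ) =
      coinduce k hT (groupTransposition (Representation.trivial k _ k) i ψ) := by
  ext1 g
  rw [groupTransposition_apply]
  simp only [coinduce, groupTransposition_apply, Representation.trivial_apply, neg_smul,
    Finset.sum_neg_distrib]
  rw [sum_conj_coinduce k hT _ (fun t => ψ (cosetSeq hT t (swapTuple i g)))
    (fun h t => by rw [cosetSeq_mul_left])]
  simp only [cosetSeq_swapTuple, mul_inv_cancel_right]

/-- Only `t = 1` contributes: `t⁻¹ x t = x` forces `t ∈ C_G(x)`, and `1` is the only representative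
there. -/
theorem coord_coinduce_self (h1 : (1 : G) ∈ T) {n : ℕ}
    (ψ : (Fin n → Subgroup.centralizer {x}) → k) (h : Fin n → Subgroup.centralizer {x}) :
    (basis (TwoCocycle.trivial G k)).coord x (coinduce k hT ψ fun i => (h i : G)) = ψ h := by
  simp only [coinduce, map_sum, map_smul, Module.Basis.coord_apply, Module.Basis.repr_self]
  rw [Finset.sum_eq_single_of_mem 1 h1]
  · simp [cosetSeq_one hT h1]
  · intro t ht hne
    rw [Finsupp.single_eq_of_ne', smul_zero]
    refine fun h' => hne (eq_one_of_mem_transversal hT h1 ht ?_)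
    rw [Subgroup.mem_centralizer_singleton_iff]
    rw [mul_assoc, inv_mul_eq_iff_eq_mul] at h'
    exact h'.symm

theorem coord_coinduce_of_not_isConj {y : G} (hxy : ¬ IsConj x y) {n : ℕ}
    (ψ : (Fin n → Subgroup.centralizer {x}) → k) (g : Fin n → G) :
    (basis (TwoCocycle.trivial G k)).coord y (coinduce k hT ψ g) = 0 := by
  simp only [coinduce, map_sum, map_smul, Module.Basis.coord_apply, Module.Basis.repr_self]
  refine Finset.sum_eq_zero fun t _ => ?_
  rw [Finsupp.single_eq_of_ne', smul_zero]
  exact fun h => hxy (isConj_iff.mpr ⟨t⁻¹, by rw [inv_inv, h]⟩)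

end Centralizer
/-! ### Maps between cohomology modules -/

section Quotients

/-- Cochain maps `ν i` and `π i` with `π i ∘ ν j = δ_{ij}` induce a split injection on the direct sum
of cohomology modules. -/
theorem exists_split_injection {k ι D : Type*} {C : ι → Type*} [CommRing k] [DecidableEq ι]
    [Finite ι] [∀ i, AddCommGroup (C i)] [∀ i, Module k (C i)] [AddCommGroup D] [Module k D]
    (Z B : ∀ i, Submodule k (C i)) (Z' B' : Submodule k D) (ν : ∀ i, C i →ₗ[k] D)
    (π : ∀ i, D →ₗ[k] C i) (hνZ : ∀ i, Z i ≤ Z'.comap (ν i)) (hνB : ∀ i, B i ≤ B'.comap (ν i))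
    (hπZ : ∀ i, Z' ≤ (Z i).comap (π i)) (hπB : ∀ i, B' ≤ (B i).comap (π i))
    (hself : ∀ i c, π i (ν i c) = c) (hne : ∀ i j c, i ≠ j → π i (ν j c) = 0) :
    ∃ (ν' : ∀ i, (Z i ⧸ (B i).submoduleOf (Z i)) →ₗ[k] (Z' ⧸ B'.submoduleOf Z'))
      (π' : ∀ i, (Z' ⧸ B'.submoduleOf Z') →ₗ[k] (Z i ⧸ (B i).submoduleOf (Z i)))
      (P : (Z' ⧸ B'.submoduleOf Z') →ₗ[k] DirectSum ι fun i => Z i ⧸ (B i).submoduleOf (Z i)),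
      (∀ i (c : Z i), ∃ h : ν i c ∈ Z', ν' i (Submodule.mkQ _ c) = Submodule.mkQ _ ⟨_, h⟩) ∧
      (∀ i (d : Z'), ∃ h : π i d ∈ Z i, π' i (Submodule.mkQ _ d) = Submodule.mkQ _ ⟨_, h⟩) ∧
      (∀ ξ i, P ξ i = π' i ξ) ∧
      P ∘ₗ DirectSum.toModule k ι (Z' ⧸ B'.submoduleOf Z') ν' = LinearMap.id ∧
      Function.Injective (DirectSum.toModule k ι (Z' ⧸ B'.submoduleOf Z') ν') ∧
      Function.Surjective P := by
  cases nonempty_fintype ι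
  let ν' (i) : (Z i ⧸ (B i).submoduleOf (Z i)) →ₗ[k] (Z' ⧸ B'.submoduleOf Z') :=
    Submodule.mapQ _ _ ((ν i).restrict (hνZ i)) fun c hc => hνB i hc
  let π' (i) : (Z' ⧸ B'.submoduleOf Z') →ₗ[k] (Z i ⧸ (B i).submoduleOf (Z i)) :=
    Submodule.mapQ _ _ ((π i).restrict (hπZ i)) fun c hc => hπB i hc
  -- Since `ι` is finite, the product of the maps `π' i` lands in the direct sum.
  let P : (Z' ⧸ B'.submoduleOf Z') →ₗ[k] DirectSum ι fun i => Z i ⧸ (B i).submoduleOf (Z i) :=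
    (DirectSum.linearEquivFunOnFintype k ι _).symm.toLinearMap ∘ₗ LinearMap.pi π'
  have hP (ξ i) : P ξ i = π' i ξ :=
    congrFun ((DirectSum.linearEquivFunOnFintype k ι _).apply_symm_apply (LinearMap.pi π' ξ)) i
  have hPν : P ∘ₗ DirectSum.toModule k ι (Z' ⧸ B'.submoduleOf Z') ν' = LinearMap.id := by
    refine DirectSum.linearMap_ext k fun j => LinearMap.ext fun ξ => DFinsupp.ext fun i => ?_
    obtain ⟨c, rfl⟩ := Submodule.mkQ_surjective _ ξ
    simp only [LinearMap.comp_apply, DirectSum.toModule_lof, LinearMap.id_apply]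
    refine (hP _ i).trans ?_
    change Submodule.mkQ _ _ = _
    by_cases h : i = j
    · subst h
      refine Eq.trans (congrArg _ (Subtype.ext (hself i c))) ?_
      exact (DirectSum.lof_apply (M := fun i => Z i ⧸ (B i).submoduleOf (Z i)) k i _).symm
    · refine Eq.trans (congrArg _ (Subtype.ext (hne i j c h) : _ = (0 : Z i))) ?_
      rw [map_zero]
      exact (DirectSum.of_eq_of_ne (β := fun i => Z i ⧸ (B i).submoduleOf (Z i)) j i _ h).symm
  have hinv : Function.LeftInverse P (DirectSum.toModule k ι (Z' ⧸ B'.submoduleOf Z') ν') :=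
    LinearMap.congr_fun hPν
  exact ⟨ν', π', P, fun i c => ⟨hνZ i c.2, rfl⟩, fun i d => ⟨hπZ i d.2, rfl⟩, hP, hPν,
    hinv.injective, hinv.surjective⟩

end Quotients

/-! ### Symmetric cocycles and coboundaries under cochain maps -/

section Symmetric

variable {k G H A : Type*} [CommRing k] [Group G] [Group H] [AddCommGroup A] [Module k A]

theorem mem_symCochains (ρ : Representation k G A) {n : ℕ} {f : (Fin n → G) → A} :
    f ∈ symCochains ρ n ↔ ∀ i, groupTransposition ρ i f = f := by
  simp [symCochains]

variable [Fintype G] {α : TwoCocycle G k}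

theorem TwistedGroupAlgebra.mem_symCochains {n : ℕ} {φ : Cochain α n} :
    φ ∈ symCochains α n ↔ ∀ i, transposition α i φ = φ := by
  simp [symCochains]

variable {ρ : Representation k H A}

/-- A family of maps from group cochains to Hochschild cochains that commutes with differentials and
transpositions preserves symmetric cocycles and coboundaries. -/
theorem le_comap_of_toHochschild
    (F : ∀ n, ((Fin n → H) → A) →ₗ[k] TwistedGroupAlgebra.Cochain α n)
    (hd : ∀ n f, hochschildDifferential k _ n (F n f) = F (n + 1) (groupDifferential ρ n f))
    (ht : ∀ n (i : Fin n) f,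
      TwistedGroupAlgebra.transposition α i (F n f) = F n (groupTransposition ρ i f)) (n : ℕ) :
    symCocycles ρ n ≤ (TwistedGroupAlgebra.symCocycles α n).comap (F n) ∧
      symCoboundaries ρ n ≤ (TwistedGroupAlgebra.symCoboundaries α n).comap (F n) := by
  have hs (n f) (hf : f ∈ symCochains ρ n) : F n f ∈ TwistedGroupAlgebra.symCochains α n :=
    TwistedGroupAlgebra.mem_symCochains.mpr fun i => by
      rw [ht, (mem_symCochains ρ).mp hf]
  refine ⟨fun f hf => ⟨hs n f hf.1, ?_⟩, ?_⟩
  · change hochschildDifferential k _ n (F n f) = 0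
    rw [hd, show groupDifferential ρ n f = 0 from hf.2, map_zero]
  · cases n with
    | zero => exact bot_le
    | succ n =>
      rintro _ ⟨f, hf, rfl⟩
      exact ⟨F n f, hs n f hf, hd n f⟩

/-- A family of maps from Hochschild cochains to group cochains that commutes with differentials and
transpositions preserves symmetric cocycles and coboundaries. -/
theorem le_comap_of_ofHochschild
    (F : ∀ n, TwistedGroupAlgebra.Cochain α n →ₗ[k] ((Fin n → H) → A))
    (hd : ∀ n φ, groupDifferential ρ n (F n φ) = F (n + 1) (hochschildDifferential k _ n φ))
    (ht : ∀ n (i : Fin n) φ,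
      groupTransposition ρ i (F n φ) = F n (TwistedGroupAlgebra.transposition α i φ)) (n : ℕ) :
    TwistedGroupAlgebra.symCocycles α n ≤ (symCocycles ρ n).comap (F n) ∧
      TwistedGroupAlgebra.symCoboundaries α n ≤ (symCoboundaries ρ n).comap (F n) := by
  have hs (n φ) (hφ : φ ∈ TwistedGroupAlgebra.symCochains α n) : F n φ ∈ symCochains ρ n :=
    (mem_symCochains ρ).mpr fun i => by
      rw [ht, TwistedGroupAlgebra.mem_symCochains.mp hφ]
  refine ⟨fun φ hφ => ⟨hs n φ hφ.1, ?_⟩, ?_⟩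
  · change groupDifferential ρ n (F n φ) = 0
    rw [hd, show hochschildDifferential k _ n φ = 0 from hφ.2, map_zero]
  · cases n with
    | zero => exact bot_le
    | succ n =>
      rintro _ ⟨φ, hφ, rfl⟩
      exact ⟨F n φ, hs n φ hφ, hd n φ⟩

end Symmetric

/-! ### Compatibility of `ν` and `π` with the symmetric complexes -/

section Maps

open TwistedGroupAlgebra

variable {k G : Type*} [CommRing k] [Group G]

theorem piCentralizer_apply (α : TwoCocycle G k) (x : G) {n : ℕ} (φ : Cochain α n) :
    piCentralizer α x n φ =
      fun h => (basis α).coord x (untwist α φ fun i => Subgroup.subtype _ (h i)) :=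
  funext fun h => congrFun (piCoeff_eq α x φ) fun i => ((h i : Subgroup.centralizer {x}) : G)

variable [Fintype G]

theorem nuCentral_le_comap (α : TwoCocycle G k) (x : Subgroup.center G) (n : ℕ) :
    _root_.symCocycles (α.lineRep x) n ≤
        (TwistedGroupAlgebra.symCocycles α n).comap (nuCentral α x n) ∧
      _root_.symCoboundaries (α.lineRep x) n ≤
        (TwistedGroupAlgebra.symCoboundaries α n).comap (nuCentral α x n) := by
  -- The inclusion `a ↦ a x̄` of the stable line is equivariant because `x` is central.
  have hL (g : G) (a : k) : LinearMap.toSpanSingleton k _ (basis α (x : G)) (α.lineRep x g a) =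
      conj α (MonoidHom.id G g) (LinearMap.toSpanSingleton k _ (basis α (x : G)) a) :=
    (smul_basis_conj α (Subgroup.mem_center_iff.mp x.2 g) a).symm
  refine le_comap_of_toHochschild (nuCentral α (x : G)) (fun n f => ?_) (fun n i f => ?_) n
  · refine untwist_injective α _ ?_
    rw [← groupDifferential_untwist, untwist_nuCentral, untwist_nuCentral]
    exact groupDifferential_comp (MonoidHom.id G) _ hL f
  · refine untwist_injective α _ ?_
    rw [← groupTransposition_untwist, untwist_nuCentral, untwist_nuCentral]
    exact groupTransposition_comp (MonoidHom.id G) _ hL i f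

theorem piCoeff_le_comap (α : TwoCocycle G k) (x : Subgroup.center G) (n : ℕ) :
    TwistedGroupAlgebra.symCocycles α n ≤
        (_root_.symCocycles (α.lineRep x) n).comap (piCoeff α x n) ∧
      TwistedGroupAlgebra.symCoboundaries α n ≤
        (_root_.symCoboundaries (α.lineRep x) n).comap (piCoeff α x n) := by
  have hL (g : G) (a) : (basis α).coord (x : G) (conj α (MonoidHom.id G g) a) =
      α.lineRep x g ((basis α).coord (x : G) a) :=
    coord_conj α (Subgroup.mem_center_iff.mp x.2 g) a
  refine le_comap_of_ofHochschild (piCoeff α (x : G)) (fun n f => ?_) (fun n i f => ?_) n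
  · rw [piCoeff_eq, piCoeff_eq, ← groupDifferential_untwist]
    exact groupDifferential_comp (MonoidHom.id G) _ hL _
  · rw [piCoeff_eq, piCoeff_eq, ← groupTransposition_untwist]
    exact groupTransposition_comp (MonoidHom.id G) _ hL i _

theorem nuCentralizer_le_comap {x : G} {T : Finset G}
    (hT : Subgroup.IsComplement (Subgroup.centralizer {x} : Set G) (T : Set G)) (n : ℕ) :
    _root_.symCocycles (Representation.trivial k (Subgroup.centralizer {x}) k) n ≤
        (TwistedGroupAlgebra.symCocycles (TwoCocycle.trivial G k) n).comap
          (nuCentralizer k hT n) ∧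
      _root_.symCoboundaries (Representation.trivial k (Subgroup.centralizer {x}) k) n ≤
        (TwistedGroupAlgebra.symCoboundaries (TwoCocycle.trivial G k) n).comap
          (nuCentralizer k hT n) := by
  refine le_comap_of_toHochschild (nuCentralizer k hT) (fun n f => ?_) (fun n i f => ?_) n
  · refine untwist_injective _ _ ?_
    rw [← groupDifferential_untwist, untwist_nuCentralizer, untwist_nuCentralizer,
      groupDifferential_coinduce]
  · refine untwist_injective _ _ ?_
    rw [← groupTransposition_untwist, untwist_nuCentralizer, untwist_nuCentralizer,
      groupTransposition_coinduce]

theorem piCentralizer_le_comap (x : G) (n : ℕ) :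
    TwistedGroupAlgebra.symCocycles (TwoCocycle.trivial G k) n ≤
        (_root_.symCocycles (Representation.trivial k (Subgroup.centralizer {x}) k) n).comap
          (piCentralizer (TwoCocycle.trivial G k) x n) ∧
      TwistedGroupAlgebra.symCoboundaries (TwoCocycle.trivial G k) n ≤
        (_root_.symCoboundaries (Representation.trivial k (Subgroup.centralizer {x}) k) n).comap
          (piCentralizer (TwoCocycle.trivial G k) x n) := by
  -- The coefficient at `x` is invariant under conjugation by elements commuting with `x`, which is
  -- why `π` restricts to `C_G(x)`.
  have hL (g : Subgroup.centralizer {x}) (a) : (basis (TwoCocycle.trivial G k)).coord x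
      (conj (TwoCocycle.trivial G k) (Subgroup.subtype _ g) a) =
      Representation.trivial k (Subgroup.centralizer {x}) k g
        ((basis (TwoCocycle.trivial G k)).coord x a) := by
    refine (coord_conj _ (Subgroup.mem_centralizer_singleton_iff.mp g.2) a).trans ?_
    change ((1 * 1⁻¹ : kˣ) : k) * _ = _
    rw [mul_inv_cancel, Units.val_one, one_mul, Representation.trivial_apply]
  refine le_comap_of_ofHochschild (piCentralizer (TwoCocycle.trivial G k) x) (fun n f => ?_)
    (fun n i f => ?_) n
  · rw [piCentralizer_apply, piCentralizer_apply, ← groupDifferential_untwist]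
    exact groupDifferential_comp (Subgroup.subtype _) _ hL _
  · rw [piCentralizer_apply, piCentralizer_apply, ← groupTransposition_untwist]
    exact groupTransposition_comp (Subgroup.subtype _) _ hL i _

end Maps

/-! ### The main theorem -/

theorem mainTheorem1 {k G : Type*} [CommRing k] [Group G] [Fintype G] [DecidableEq G] (n : ℕ) :
    (∀ α : TwoCocycle G k,
      ∃ (ν : ∀ x : Subgroup.center G, HS (α.lineRep x) n →ₗ[k] TwistedGroupAlgebra.HHS α n)
        (π : ∀ x : Subgroup.center G, TwistedGroupAlgebra.HHS α n →ₗ[k] HS (α.lineRep x) n)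
        (P : TwistedGroupAlgebra.HHS α n →ₗ[k]
          DirectSum (Subgroup.center G) fun x => HS (α.lineRep x) n),
        (∀ (x : Subgroup.center G) (ψ : symCocycles (α.lineRep x) n),
          ∃ h : TwistedGroupAlgebra.nuCentral α (x : G) n ψ ∈ TwistedGroupAlgebra.symCocycles α n,
            ν x (HS.mk (α.lineRep x) n ψ) = TwistedGroupAlgebra.HHS.mk α n ⟨_, h⟩) ∧
        (∀ (x : Subgroup.center G) (φ : TwistedGroupAlgebra.symCocycles α n),
          ∃ h : TwistedGroupAlgebra.piCoeff α (x : G) n φ ∈ symCocycles (α.lineRep x) n,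
            π x (TwistedGroupAlgebra.HHS.mk α n φ) = HS.mk (α.lineRep x) n ⟨_, h⟩) ∧
        (∀ ξ x, P ξ x = π x ξ) ∧
        P ∘ₗ DirectSum.toModule k (Subgroup.center G) (TwistedGroupAlgebra.HHS α n) ν =
          LinearMap.id ∧
        Function.Injective
          (DirectSum.toModule k (Subgroup.center G) (TwistedGroupAlgebra.HHS α n) ν) ∧
        Function.Surjective P) ∧
    (∀ (X : Set G) (_ : ∀ g : G, ∃! x, x ∈ X ∧ IsConj x g)
      (T : X → Finset G) (_ : ∀ x, (1 : G) ∈ T x)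
      (hT : ∀ x : X, Subgroup.IsComplement (Subgroup.centralizer {(x : G)} : Set G) (T x : Set G)),
      ∃ (ν : ∀ x : X, HS (Representation.trivial k (Subgroup.centralizer {(x : G)}) k) n →ₗ[k]
          TwistedGroupAlgebra.HHS (TwoCocycle.trivial G k) n)
        (π : ∀ x : X, TwistedGroupAlgebra.HHS (TwoCocycle.trivial G k) n →ₗ[k]
          HS (Representation.trivial k (Subgroup.centralizer {(x : G)}) k) n)
        (P : TwistedGroupAlgebra.HHS (TwoCocycle.trivial G k) n →ₗ[k]
          DirectSum X fun x => HS (Representation.trivial k (Subgroup.centralizer {(x : G)}) k) n),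
        (∀ (x : X) (ψ : symCocycles
            (Representation.trivial k (Subgroup.centralizer {(x : G)}) k) n),
          ∃ h : nuCentralizer k (hT x) n ψ ∈
              TwistedGroupAlgebra.symCocycles (TwoCocycle.trivial G k) n,
            ν x (HS.mk (Representation.trivial k (Subgroup.centralizer {(x : G)}) k) n ψ) =
              TwistedGroupAlgebra.HHS.mk (TwoCocycle.trivial G k) n ⟨_, h⟩) ∧
        (∀ (x : X) (φ : TwistedGroupAlgebra.symCocycles (TwoCocycle.trivial G k) n),
          ∃ h : TwistedGroupAlgebra.piCentralizer (TwoCocycle.trivial G k) (x : G) n φ ∈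
              symCocycles (Representation.trivial k (Subgroup.centralizer {(x : G)}) k) n,
            π x (TwistedGroupAlgebra.HHS.mk (TwoCocycle.trivial G k) n φ) =
              HS.mk (Representation.trivial k (Subgroup.centralizer {(x : G)}) k) n ⟨_, h⟩) ∧
        (∀ ξ x, P ξ x = π x ξ) ∧
        P ∘ₗ DirectSum.toModule k X (TwistedGroupAlgebra.HHS (TwoCocycle.trivial G k) n) ν =
          LinearMap.id ∧
        Function.Injective
          (DirectSum.toModule k X (TwistedGroupAlgebra.HHS (TwoCocycle.trivial G k) n) ν) ∧
        Function.Surjective P) := by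
  constructor
  · intro α
    refine exists_split_injection (fun x => symCocycles (α.lineRep x) n)
      (fun x => symCoboundaries (α.lineRep x) n) (TwistedGroupAlgebra.symCocycles α n)
      (TwistedGroupAlgebra.symCoboundaries α n)
      (fun x : Subgroup.center G => TwistedGroupAlgebra.nuCentral α x n)
      (fun x => TwistedGroupAlgebra.piCoeff α x n)
      (fun x => (nuCentral_le_comap α x n).1) (fun x => (nuCentral_le_comap α x n).2)
      (fun x => (piCoeff_le_comap α x n).1) (fun x => (piCoeff_le_comap α x n).2)
      (fun x ψ => ?_) (fun x y ψ hxy => ?_)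
    · rw [TwistedGroupAlgebra.piCoeff_eq, TwistedGroupAlgebra.untwist_nuCentral]
      simp
    · rw [TwistedGroupAlgebra.piCoeff_eq, TwistedGroupAlgebra.untwist_nuCentral]
      ext g
      simp [Finsupp.single_eq_of_ne' (fun h => hxy (Subtype.ext h.symm))]
  · intro X hX T h1 hT
    refine exists_split_injection
      (fun x : X => symCocycles (Representation.trivial k (Subgroup.centralizer {(x : G)}) k) n)
      (fun x => symCoboundaries (Representation.trivial k (Subgroup.centralizer {(x : G)}) k) n)
      (TwistedGroupAlgebra.symCocycles (TwoCocycle.trivial G k) n)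
      (TwistedGroupAlgebra.symCoboundaries (TwoCocycle.trivial G k) n)
      (fun x => nuCentralizer k (hT x) n)
      (fun x => TwistedGroupAlgebra.piCentralizer (TwoCocycle.trivial G k) (x : G) n)
      (fun x => (nuCentralizer_le_comap (hT x) n).1) (fun x => (nuCentralizer_le_comap (hT x) n).2)
      (fun x => (piCentralizer_le_comap (x : G) n).1)
      (fun x => (piCentralizer_le_comap (x : G) n).2) (fun x ψ => ?_) (fun x y ψ hxy => ?_)
    · rw [piCentralizer_apply, untwist_nuCentralizer]
      exact funext fun h => coord_coinduce_self k (hT x) (h1 x) ψ h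
    · rw [piCentralizer_apply, untwist_nuCentralizer]
      refine funext fun h => coord_coinduce_of_not_isConj k (hT y) (fun hc => hxy ?_) ψ _
      -- Two conjugate representatives in `X` coincide.
      exact Subtype.ext ((hX x).unique ⟨x.2, IsConj.refl _⟩ ⟨y.2, hc⟩)
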